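/- Let $I$ be a set. An \emph{$I$-dimensional cylindric Boolean algebra} is a Boolean algebra $A$ with unary operations $(\exists_i)_{i\in I}$ and constants $(\delta_{i,k})_{i,k\in I}$ such that for all $i,k,l\in I$ and $a,b\in A$: each $\exists_i$ is a quantifier, i.e. $\exists_i(a\vee b)=\exists_i a\vee\exists_i b$, $\exists_i 0=0$, $\exists_i\exists_i a=\exists_i a$, $a\le\exists_i a$ and $\exists_i\bigl((\exists_i a)^{\perp}\bigr)=(\exists_i a)^{\perp}$, where $^{\perp}$ is the Boolean complement; $\exists_i\exists_k a=\exists_k\exists_i a$; $\delta_{i,k}=\delta_{k,i}$ and $\delta_{i,i}=1$; if $k\ne i,l$, then $\delta_{i,l}=\exists_k(\delta_{i,k}\wedge\delta_{k,l})$; if $i\ne k$, then $\exists_i(\delta_{i,k}\wedge a)\wedge\exists_i(\delta_{i,k}\wedge a^{\perp})=0$. Let $\mathcal{CBA}$ be the category of these algebras and of the Boolean homomorphisms $h$ with $h(\exists_i a)=\exists_i h(a)$ and $h(\delta_{i,k})=\delta_{i,k}$. For a topological space $X$ let $x\leqslant y$ iff every open set containing $x$ contains $y$, let $\mathrm{Int}_\leqslant(U)=\{x: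 y\in U\text{ for all }y\geqslant x\}$, $\mathrm{Cl}_\leqslant(U)=\{x: y\in U\text{ for some }y\geqslant x\}$ and $U^*=\mathrm{Int}_\leqslant(X\setminus U)$, and let $\mathcal{COREG}(X)$ be the set of all compact open $U\subseteq X$ with $\mathrm{Int}_\leqslant(\mathrm{Cl}_\leqslant(U))=U$, ordered by inclusion; put $\mathcal{COREG}_X(x)=\{U\in\mathcal{COREG}(X): x\in U\}$. A \emph{UV-space} is a $T_0$-space $X$ such that $\mathcal{COREG}(X)$ is a basis of $X$ closed under $\cap$ and $^*$, and every proper filter of $\mathcal{COREG}(X)$ is of the form $\mathcal{COREG}_X(x)$ with $x\in X$. For a binary relation $S$ on $X$ put $S[U]=\{y: xSy\text{ for some }x\in U\}$. An \emph{$I$-dimensional cylindric UV-space} is a UV-space $X$ with binary relations $(S_i)_{i\in I}$ and subsets $(\Delta_{i,k})_{i,k\in I}$ such that for all $i,k,l\in I$, $x,y\in X$ and $U\in\mathcal{COREG}(X)$: $S_i$ is an equivalence relation; $S_i\circ S_k=S_k\circ S_i$; $\Delta_{i,k}^{**}=\Delta_{i,k}=\Delta_{k,i}$ and $\Delta_{i,i}=X$;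 if $i,l\ne k$, then $S_k[\Delta_{i,k}\cap\Delta_{k,l}]=\Delta_{i,l}$; if $i\ne k$, then $S_i[\Delta_{i,k}\cap U]\cap S_i[\Delta_{i,k}\cap U^*]=\emptyset$; $S_i[U]\in\mathcal{COREG}(X)$; if not $xS_iy$, then $\{S_i[V]:V\in\mathcal{COREG}_X(x)\}\ne\{S_i[V]:V\in\mathcal{COREG}_X(y)\}$; $\Delta_{i,k}$ is compact open. A \emph{cylindric UV-map} $f\colon X\to X'$ is a spectral map (continuous, with preimages of compact open sets compact) such that: if $f(x)\leqslant' y'$, there is $y\in X$ with $x\leqslant y$ and $f(y)=y'$; $S_i[f^{-1}[U]]=f^{-1}[S'_i[U]]$ for all $i\in I$ and $U\in\mathcal{COREG}(X')$; and $f^{-1}[\Delta'_{i,k}]=\Delta_{i,k}$ for all $i,k\in I$. Let $\mathcal{CUV}$ be the category of $I$-dimensional cylindric UV-spaces and cylindric UV-maps. For $X$ in $\mathcal{CUV}$ let $\mathcal{G}_0(X)=\langle\mathcal{COREG}(X);\cap,\sqcup,{}^*,\emptyset,X,(U\mapsto S_i[U])_{i\in I},(\Delta_{i,k})_{i,k\in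 I}\rangle$ with $U\sqcup V=\mathrm{Int}_\leqslant(\mathrm{Cl}_\leqslant(U\cup V))$, and for a cylindric UV-map $f$ let $\mathcal{G}_1(f)=f^{-1}$. For $A$ in $\mathcal{CBA}$ let $\mathcal{F}_0(A)$ be the set of proper (non-empty) filters of $A$ with the topology generated by the sets $\phi(a)=\{x: a\in x\}$, $a\in A$, the relations $xS_iy\iff\exists_i[x]=\exists_i[y]$, where $\exists_i[x]=\{\exists_i a: a\in x\}$, and the subsets $\Delta_{i,k}=\phi(\delta_{i,k})$; for a homomorphism $h$ let $\mathcal{F}_1(h)=h^{-1}$. Then the contravariant functors $\mathcal{G}_F=\langle\mathcal{G}_0,\mathcal{G}_1\rangle\colon\mathcal{CUV}\to\mathcal{CBA}$ and $\mathcal{F}_F=\langle\mathcal{F}_0,\mathcal{F}_1\rangle\colon\mathcal{CBA}\to\mathcal{CUV}$ constitute a dual equivalence between the categories $\mathcal{CBA}$ and $\mathcal{CUV}$. -/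

import Mathlib

open CategoryTheory

universe u v

namespace CylDual

/-! ### Order-theoretic operations in a topological space -/

section Space

variable {X : Type u} [TopologicalSpace X]

/-- The specialization order: `x ≤ y` iff every open set containing `x` contains `y`. -/
def SpecLE (x y : X) : Prop := ∀ U : Set X, IsOpen U → x ∈ U → y ∈ U

/-- Interior in the topology of upsets of the specialization order. -/
def intUp (U : Set X) : Set X := {x | ∀ y, SpecLE x y → y ∈ U}

/-- Closure in the topology of upsets of the specialization order. -/
def clUp (U : Set X) : Set X := {x | ∃ y, SpecLE x y ∧ y ∈ U}

/-- The operation `U ↦ U*`, i.e. `Int (X \ U)` in the upset topology. -/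
def star (U : Set X) : Set X := intUp Uᶜ

/-- Compact open subsets that are regular open in the upset topology. -/
structure IsCOREG (U : Set X) : Prop where
  isCompact : IsCompact U
  isOpen : IsOpen U
  regular : intUp (clUp U) = U

variable (X) in
/-- The poset (under inclusion) of compact open, upset-regular open subsets of `X`. -/
abbrev COREG : Type u := {U : Set X // IsCOREG U}

/-- Image of a set under a binary relation. -/
def relImage {X : Type u} (S : X → X → Prop) (U : Set X) : Set X := {y | ∃ x ∈ U, S x y}

variable (X) in
/-- UV-spaces. -/
structure IsUVSpace : Prop where
  t0 : T0Space X
  inter_mem : ∀ U V : Set X, IsCOREG U → IsCOREG V → IsCOREG (U ∩ V)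
  star_mem : ∀ U : Set X, IsCOREG U → IsCOREG (star U)
  isBasis : TopologicalSpace.IsTopologicalBasis {U : Set X | IsCOREG U}
  exists_point : ∀ F : Order.PFilter (COREG X), (F : Set (COREG X)) ≠ Set.univ →
    ∃ x : X, (F : Set (COREG X)) = {U | x ∈ U.1}

end Space

/-! ### Cylindric Boolean algebras -/

/-- A quantifier on a Boolean algebra. -/
structure IsQuantifier {A : Type u} [BooleanAlgebra A] (e : A → A) : Prop where
  map_sup : ∀ a b, e (a ⊔ b) = e a ⊔ e b
  map_bot : e ⊥ = ⊥
  idem : ∀ a, e (e a) = e a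
  le : ∀ a, a ≤ e a
  map_compl : ∀ a, e (e a)ᶜ = (e a)ᶜ

/-- `I`-dimensional cylindric Boolean algebras. -/
structure CBA (I : Type v) where
  carrier : Type u
  [ba : BooleanAlgebra carrier]
  ex : I → carrier → carrier
  diag : I → I → carrier
  quantifier : ∀ i, IsQuantifier (ex i)
  ex_comm : ∀ i k a, ex i (ex k a) = ex k (ex i a)
  diag_symm : ∀ i k, diag i k = diag k i
  diag_self : ∀ i, diag i i = ⊤
  diag_trans : ∀ i k l, k ≠ i → k ≠ l → diag i l = ex k (diag i k ⊓ diag k l)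
  diag_disj : ∀ i k a, i ≠ k → ex i (diag i k ⊓ a) ⊓ ex i (diag i k ⊓ aᶜ) = ⊥

attribute [instance] CBA.ba

/-- Homomorphisms of cylindric Boolean algebras. -/
@[ext]
structure CBA.Hom {I : Type v} (A B : CBA.{u} I) where
  toFun : A.carrier → B.carrier
  map_inf : ∀ a b, toFun (a ⊓ b) = toFun a ⊓ toFun b
  map_sup : ∀ a b, toFun (a ⊔ b) = toFun a ⊔ toFun b
  map_bot : toFun ⊥ = ⊥
  map_top : toFun ⊤ = ⊤
  map_compl : ∀ a, toFun aᶜ = (toFun a)ᶜ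
  map_ex : ∀ i a, toFun (A.ex i a) = B.ex i (toFun a)
  map_diag : ∀ i k, toFun (A.diag i k) = B.diag i k

instance (I : Type v) : Category.{u} (CBA.{u} I) where
  Hom A B := CBA.Hom A B
  id A :=
    { toFun := id
      map_inf := fun _ _ => rfl
      map_sup := fun _ _ => rfl
      map_bot := rfl
      map_top := rfl
      map_compl := fun _ => rfl
      map_ex := fun _ _ => rfl
      map_diag := fun _ _ => rfl }
  comp f g :=
    { toFun := g.toFun ∘ f.toFun
      map_inf := fun a b => by simp [f.map_inf, g.map_inf]
      map_sup := fun a b => by simp [f.map_sup, g.map_sup]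
      map_bot := by simp [f.map_bot, g.map_bot]
      map_top := by simp [f.map_top, g.map_top]
      map_compl := fun a => by simp [f.map_compl, g.map_compl]
      map_ex := fun i a => by simp [f.map_ex, g.map_ex]
      map_diag := fun i k => by simp [f.map_diag, g.map_diag] }

/-! ### Cylindric UV-spaces -/

/-- `I`-dimensional cylindric UV-spaces. -/
structure CUV (I : Type v) where
  carrier : Type u
  [top : TopologicalSpace carrier]
  S : I → carrier → carrier → Prop
  Δ : I → I → Set carrier
  isUV : IsUVSpace carrier
  equiv : ∀ i, Equivalence (S i)
  comm : ∀ i k, Relation.Comp (S i) (S k) = Relation.Comp (S k) (S i)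
  diag_regular : ∀ i k, star (star (Δ i k)) = Δ i k
  diag_symm : ∀ i k, Δ i k = Δ k i
  diag_self : ∀ i, Δ i i = Set.univ
  diag_trans : ∀ i k l, i ≠ k → l ≠ k → relImage (S k) (Δ i k ∩ Δ k l) = Δ i l
  diag_disj : ∀ i k, i ≠ k → ∀ U, IsCOREG U →
    relImage (S i) (Δ i k ∩ U) ∩ relImage (S i) (Δ i k ∩ star U) = ∅
  image_mem : ∀ i U, IsCOREG U → IsCOREG (relImage (S i) U)
  separated : ∀ i x y, ¬ S i x y →
    relImage (S i) '' {U | IsCOREG U ∧ x ∈ U} ≠ relImage (S i) '' {U | IsCOREG U ∧ y ∈ U}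
  diag_compact : ∀ i k, IsCompact (Δ i k)
  diag_open : ∀ i k, IsOpen (Δ i k)

attribute [instance] CUV.top

/-- Cylindric UV-maps. -/
@[ext]
structure CUV.Hom {I : Type v} (X Y : CUV.{u} I) where
  toFun : X.carrier → Y.carrier
  spectral : IsSpectralMap toFun
  back : ∀ x y', SpecLE (toFun x) y' → ∃ y, SpecLE x y ∧ toFun y = y'
  preimage_image : ∀ i U, IsCOREG U →
    relImage (X.S i) (toFun ⁻¹' U) = toFun ⁻¹' relImage (Y.S i) U
  preimage_diag : ∀ i k, toFun ⁻¹' Y.Δ i k = X.Δ i k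

section Lemmas

variable {X Y : Type u} [TopologicalSpace X] [TopologicalSpace Y]

lemma SpecLE.refl (x : X) : SpecLE x x := fun _ _ h => h

lemma SpecLE.trans {x y z : X} (h : SpecLE x y) (h' : SpecLE y z) : SpecLE x z :=
  fun U hU hx => h' U hU (h U hU hx)

lemma SpecLE.map {f : X → Y} (hf : Continuous f) {x y : X} (h : SpecLE x y) :
    SpecLE (f x) (f y) := fun _ hU hx => h _ (hU.preimage hf) hx

lemma star_star (U : Set X) : star (star U) = intUp (clUp U) := by
  ext x
  simp only [star, intUp, clUp, Set.mem_ofPred_eq, Set.mem_compl_iff]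
  push Not
  rfl

lemma IsCOREG.up {U : Set X} (h : IsCOREG U) {x y : X} (hxy : SpecLE x y) (hx : x ∈ U) : y ∈ U :=
  hxy U h.isOpen hx

lemma IsCOREG.star_star {U : Set X} (h : IsCOREG U) : star (star U) = U :=
  (CylDual.star_star U).trans h.regular

lemma isCOREG_empty : IsCOREG (∅ : Set X) := by
  refine ⟨isCompact_empty, isOpen_empty, ?_⟩
  ext x
  simp only [intUp, clUp, Set.mem_ofPred_eq, Set.mem_empty_iff_false, and_false, exists_false,
    iff_false]
  exact fun h => h x (SpecLE.refl x)

lemma star_empty : star (∅ : Set X) = Set.univ := by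
  ext x
  simp [star, intUp]

lemma star_union (U V : Set X) : star (U ∪ V) = star U ∩ star V := by
  ext x
  constructor
  · exact fun h => ⟨fun y hy hU => h y hy (Or.inl hU), fun y hy hV => h y hy (Or.inr hV)⟩
  · rintro ⟨h1, h2⟩ y hy (hU | hV)
    · exact h1 y hy hU
    · exact h2 y hy hV

lemma IsUVSpace.univ_mem (h : IsUVSpace X) : IsCOREG (Set.univ : Set X) :=
  star_empty (X := X) ▸ h.star_mem _ isCOREG_empty

lemma IsUVSpace.sup_mem (h : IsUVSpace X) {U V : Set X} (hU : IsCOREG U) (hV : IsCOREG V) :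
    IsCOREG (intUp (clUp (U ∪ V))) :=
  star_star (U ∪ V) ▸ star_union U V ▸ h.star_mem _ (h.inter_mem _ _ (h.star_mem _ hU) (h.star_mem _ hV))

/-- The Boolean algebra `⟨COREG(X); ∩, ⊔, *, ∅, X⟩`, with `U ⊔ V = Int (Cl (U ∪ V))` computed in
the upset topology. Its order is inclusion. -/
abbrev IsUVSpace.booleanAlgebra (h : IsUVSpace X) : BooleanAlgebra (COREG X) where
  toPartialOrder := inferInstance
  inf U V := ⟨U.1 ∩ V.1, h.inter_mem _ _ U.2 V.2⟩
  sup U V := ⟨intUp (clUp (U.1 ∪ V.1)), h.sup_mem U.2 V.2⟩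
  compl U := ⟨star U.1, h.star_mem _ U.2⟩
  bot := ⟨∅, isCOREG_empty⟩
  top := ⟨Set.univ, h.univ_mem⟩
  inf_le_left _ _ := fun _ hx => hx.1
  inf_le_right _ _ := fun _ hx => hx.2
  le_inf _ _ _ h1 h2 := fun _ hx => ⟨h1 hx, h2 hx⟩
  le_sup_left U V := fun x hx y hy => ⟨y, SpecLE.refl y, Or.inl (U.2.up hy hx)⟩
  le_sup_right U V := fun x hx y hy => ⟨y, SpecLE.refl y, Or.inr (V.2.up hy hx)⟩
  sup_le U V W h1 h2 := fun x hx => by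
    rw [← W.2.regular]
    intro y hy
    obtain ⟨z, hz, hzU | hzV⟩ := hx y hy
    · exact ⟨z, hz, h1 hzU⟩
    · exact ⟨z, hz, h2 hzV⟩
  le_sup_inf U V W := by
    rintro x ⟨hx1, hx2⟩ y hy
    obtain ⟨z, hz, hzU | hzV⟩ := hx1 y hy
    · exact ⟨z, hz, Or.inl hzU⟩
    · obtain ⟨w, hw, hwU | hwW⟩ := hx2 z (hy.trans hz)
      · exact ⟨w, hz.trans hw, Or.inl hwU⟩
      · exact ⟨w, hz.trans hw, Or.inr ⟨V.2.up hw hzV, hwW⟩⟩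
  inf_compl_le_bot _ := fun x hx => hx.2 x (SpecLE.refl x) hx.1
  top_le_sup_compl U := fun x _ y _ => by
    by_cases hc : ∃ z, SpecLE y z ∧ z ∈ U.1
    · obtain ⟨z, hz, hzU⟩ := hc
      exact ⟨z, hz, Or.inl hzU⟩
    · exact ⟨y, SpecLE.refl y, Or.inr fun z hz hzU => hc ⟨z, hz, hzU⟩⟩
  le_top _ := fun _ _ => trivial
  bot_le _ := fun _ hx => hx.elim

end Lemmas

/-- A closure-type operation commuting with relativized meets is a quantifier. -/
lemma IsQuantifier.of_meet {A : Type u} [BooleanAlgebra A] {e : A → A} (h0 : e ⊥ = ⊥)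
    (hle : ∀ a, a ≤ e a) (hm : ∀ a b, e (a ⊓ e b) = e a ⊓ e b) : IsQuantifier e := by
  have idem : ∀ a, e (e a) = e a := fun a => by
    have h := hm ⊤ a
    have ht : e ⊤ = ⊤ := top_le_iff.1 (hle ⊤)
    simpa [ht] using h
  have mono : ∀ {a b}, a ≤ b → e a ≤ e b := fun {a b} hab => by
    have h := hm a b
    rw [inf_eq_left.2 (hab.trans (hle b))] at h
    exact inf_eq_left.1 h.symm
  have compl : ∀ a, e (e a)ᶜ = (e a)ᶜ := fun a => by
    refine le_antisymm ?_ (hle _)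
    have h := hm (e a)ᶜ a
    rw [compl_inf_eq_bot, h0] at h
    exact le_compl_iff_disjoint_right.2 (disjoint_iff.2 h.symm)
  refine ⟨fun a b => le_antisymm ?_ (sup_le (mono le_sup_left) (mono le_sup_right)), h0, idem, hle,
    compl⟩
  have h1 : e (e a ⊔ e b) = e a ⊔ e b := by
    have h2 : e ((e a)ᶜ ⊓ (e b)ᶜ) = (e a)ᶜ ⊓ (e b)ᶜ := by
      have h := hm (e a)ᶜ (e b)ᶜ
      rwa [compl, compl] at h
    have h3 := compl ((e a)ᶜ ⊓ (e b)ᶜ)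
    rw [h2] at h3
    simpa using h3
  exact (mono (sup_le_sup (hle a) (hle b))).trans h1.le


lemma preimage_star {X Y : Type u} [TopologicalSpace X] [TopologicalSpace Y] {f : X → Y}
    (hf : Continuous f) (hb : ∀ x y', SpecLE (f x) y' → ∃ y, SpecLE x y ∧ f y = y') (U : Set Y) :
    f ⁻¹' star U = star (f ⁻¹' U) := by
  ext x
  constructor
  · exact fun hx y hy hyU => hx (f y) (hy.map hf) hyU
  · intro hx y' hy' hU
    obtain ⟨y, hy, rfl⟩ := hb x y' hy'
    exact hx y hy hU

namespace CUV

variable {I : Type v}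

lemma Hom.preimage_mem {X Y : CUV.{u} I} (f : Hom X Y) {U : Set Y.carrier} (hU : IsCOREG U) :
    IsCOREG (f.toFun ⁻¹' U) := by
  refine ⟨hU.isCompact.preimage_of_isOpen f.spectral hU.isOpen,
    hU.isOpen.preimage f.spectral.continuous, ?_⟩
  rw [← star_star, ← preimage_star f.spectral.continuous f.back,
    ← preimage_star f.spectral.continuous f.back, hU.star_star]

instance : Category.{u} (CUV.{u} I) where
  Hom X Y := Hom X Y
  id X :=
    { toFun := id
      spectral := isSpectralMap_id
      back := fun _ y' h => ⟨y', h, rfl⟩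
      preimage_image := fun _ _ _ => rfl
      preimage_diag := fun _ _ => rfl }
  comp f g :=
    { toFun := g.toFun ∘ f.toFun
      spectral := g.spectral.comp f.spectral
      back := fun x z' h => by
        obtain ⟨y', hy', rfl⟩ := g.back _ _ h
        obtain ⟨y, hy, rfl⟩ := f.back _ _ hy'
        exact ⟨y, hy, rfl⟩
      preimage_image := fun i U hU => by
        rw [Set.preimage_comp, Set.preimage_comp, f.preimage_image i _ (g.preimage_mem hU),
          g.preimage_image i U hU]
      preimage_diag := fun i k => by
        rw [Set.preimage_comp, g.preimage_diag, f.preimage_diag] }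

lemma diag_mem (X : CUV.{u} I) (i k : I) : IsCOREG (X.Δ i k) :=
  ⟨X.diag_compact i k, X.diag_open i k, (star_star _).symm.trans (X.diag_regular i k)⟩

lemma image_image_comm (X : CUV.{u} I) (i k : I) (U : Set X.carrier) :
    relImage (X.S i) (relImage (X.S k) U) = relImage (X.S k) (relImage (X.S i) U) := by
  have key : ∀ i k, relImage (X.S i) (relImage (X.S k) U) ⊆
      relImage (X.S k) (relImage (X.S i) U) := by
    rintro i k z ⟨y, ⟨x, hx, hxy⟩, hyz⟩
    have h : Relation.Comp (X.S k) (X.S i) x z := ⟨y, hxy, hyz⟩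
    rw [X.comm k i] at h
    obtain ⟨w, hxw, hwz⟩ := h
    exact ⟨w, ⟨x, hx, hxw⟩, hwz⟩
  exact Set.Subset.antisymm (key i k) (key k i)

end CUV

/-! ### The functor of compact open regular opens -/

/-- The cylindric Boolean algebra of compact open regular open subsets, where the quantifiers are
`U ↦ S i [U]`. -/
def G₀ {I : Type v} (X : CUV.{u} I) : CBA.{u} I :=
  letI : BooleanAlgebra (COREG X.carrier) := X.isUV.booleanAlgebra
  { carrier := COREG X.carrier
    ex := fun i U => ⟨relImage (X.S i) U.1, X.image_mem i _ U.2⟩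
    diag := fun i k => ⟨X.Δ i k, X.diag_mem i k⟩
    quantifier := fun i => IsQuantifier.of_meet
      (Subtype.ext (Set.eq_empty_of_forall_notMem fun _ ⟨_, h, _⟩ => h))
      (fun U x hx => ⟨x, hx, (X.equiv i).refl x⟩)
      (fun U V => Subtype.ext (by
        ext y
        constructor
        · rintro ⟨x, ⟨hxU, z, hzV, hzx⟩, hxy⟩
          exact ⟨⟨x, hxU, hxy⟩, z, hzV, (X.equiv i).trans hzx hxy⟩
        · rintro ⟨⟨x, hxU, hxy⟩, z, hzV, hzy⟩
          exact ⟨x, ⟨hxU, z, hzV, (X.equiv i).trans hzy ((X.equiv i).symm hxy)⟩, hxy⟩))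
    ex_comm := fun i k U => Subtype.ext (X.image_image_comm i k U.1)
    diag_symm := fun i k => Subtype.ext (X.diag_symm i k)
    diag_self := fun i => Subtype.ext (X.diag_self i)
    diag_trans := fun i k l hi hl => Subtype.ext (X.diag_trans i k l hi.symm hl.symm).symm
    diag_disj := fun i k U h => Subtype.ext (X.diag_disj i k h U.1 U.2) }

/-- The action `f ↦ f⁻¹` on cylindric UV-maps. -/
def G₁ {I : Type v} {X Y : CUV.{u} I} (f : X ⟶ Y) : G₀ Y ⟶ G₀ X where
  toFun U := ⟨f.toFun ⁻¹' U.1, CUV.Hom.preimage_mem f U.2⟩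
  map_inf _ _ := rfl
  map_sup U V := Subtype.ext (by
    change f.toFun ⁻¹' intUp (clUp (U.1 ∪ V.1)) =
      intUp (clUp (f.toFun ⁻¹' U.1 ∪ f.toFun ⁻¹' V.1))
    rw [← star_star, ← star_star, preimage_star f.spectral.continuous f.back,
      preimage_star f.spectral.continuous f.back]
    rfl)
  map_bot := rfl
  map_top := rfl
  map_compl U := Subtype.ext (preimage_star f.spectral.continuous f.back U.1)
  map_ex i U := Subtype.ext (f.preimage_image i U.1 U.2).symm
  map_diag i k := Subtype.ext (f.preimage_diag i k)

/-- The contravariant functor from cylindric UV-spaces to cylindric Boolean algebras. -/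
def G (I : Type v) : (CUV.{u} I)ᵒᵖ ⥤ CBA.{u} I where
  obj X := G₀ X.unop
  map f := G₁ f.unop

/-! ### The functor of proper filters -/

/-- The set of proper (non-empty) filters of a Boolean algebra. -/
abbrev ProperFilter (A : Type u) [BooleanAlgebra A] : Type u :=
  {x : Order.PFilter A // (x : Set A) ≠ Set.univ}

/-- `φ a` is the set of proper filters containing `a`. -/
def φ {A : Type u} [BooleanAlgebra A] (a : A) : Set (ProperFilter A) := {x | a ∈ x.1}

/-- The topology generated by the sets `φ a`. -/
instance {A : Type u} [BooleanAlgebra A] : TopologicalSpace (ProperFilter A) :=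
  TopologicalSpace.generateFrom (Set.range φ)

section Filters

variable {A : Type u} [BooleanAlgebra A]

lemma ProperFilter.bot_notMem (x : ProperFilter A) : ⊥ ∉ x.1 := fun h =>
  x.2 (Set.eq_univ_of_forall fun _ => x.1.mem_of_le bot_le h)

/-- The proper filter generated by a non-empty set closed under meets and not containing `⊥`. -/
def ProperFilter.gen (B : Set A) (hne : B.Nonempty) (hinf : ∀ a ∈ B, ∀ b ∈ B, a ⊓ b ∈ B)
    (hbot : ⊥ ∉ B) : ProperFilter A :=
  ⟨Order.IsPFilter.toPFilter (F := {c | ∃ p ∈ B, p ≤ c}) (Order.IsPFilter.of_def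
    (hne.mono fun a ha => ⟨a, ha, le_rfl⟩)
    (by
      rintro a ⟨p, hp, hpa⟩ b ⟨q, hq, hqb⟩
      exact ⟨p ⊓ q, ⟨p ⊓ q, hinf p hp q hq, le_rfl⟩, inf_le_left.trans hpa,
        inf_le_right.trans hqb⟩)
    (by
      rintro a b hab ⟨p, hp, hpa⟩
      exact ⟨p, hp, hpa.trans hab⟩)),
    fun h => by
      have hm : ∃ p ∈ B, p ≤ (⊥ : A) := Set.eq_univ_iff_forall.1 h ⊥
      obtain ⟨p, hp, hpb⟩ := hm
      exact hbot (le_bot_iff.1 hpb ▸ hp)⟩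

lemma ProperFilter.mem_gen {B : Set A} {hne : B.Nonempty} {hinf : ∀ a ∈ B, ∀ b ∈ B, a ⊓ b ∈ B}
    {hbot : ⊥ ∉ B} {c : A} : c ∈ (gen B hne hinf hbot).1 ↔ ∃ p ∈ B, p ≤ c := Iff.rfl

lemma ProperFilter.ext' {x y : ProperFilter A} (h : ∀ a, a ∈ x.1 ↔ a ∈ y.1) : x = y :=
  Subtype.ext (SetLike.ext h)

/-- The principal proper filter of a non-zero element. -/
def ProperFilter.up (a : A) (ha : a ≠ ⊥) : ProperFilter A :=
  gen {a} ⟨a, rfl⟩ (by rintro _ rfl _ rfl; exact inf_idem _) (fun h => ha h.symm)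

lemma ProperFilter.mem_up {a : A} {ha : a ≠ ⊥} {c : A} : c ∈ (up a ha).1 ↔ a ≤ c := by
  refine mem_gen.trans ?_
  simp

lemma φ_inf (a b : A) : φ (a ⊓ b) = φ a ∩ φ b := by
  ext x
  exact Order.PFilter.inf_mem_iff

lemma φ_bot : φ (⊥ : A) = ∅ := Set.eq_empty_of_forall_notMem fun x hx => x.bot_notMem hx

lemma φ_top : φ (⊤ : A) = Set.univ := Set.eq_univ_of_forall fun x => x.1.top_mem

lemma φ_basis : TopologicalSpace.IsTopologicalBasis (Set.range (φ (A := A))) where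
  exists_subset_inter := by
    rintro _ ⟨a, rfl⟩ _ ⟨b, rfl⟩ x hx
    exact ⟨φ (a ⊓ b), ⟨_, rfl⟩, φ_inf a b ▸ hx, (φ_inf a b).le⟩
  sUnion_eq := Set.eq_univ_of_forall fun x => ⟨φ ⊤, ⟨⊤, rfl⟩, x.1.top_mem⟩
  eq_generateFrom := rfl

lemma isOpen_φ (a : A) : IsOpen (φ a) := φ_basis.isOpen ⟨a, rfl⟩

lemma specLE_iff {x y : ProperFilter A} : SpecLE x y ↔ ∀ a, a ∈ x.1 → a ∈ y.1 := by
  constructor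
  · exact fun h a ha => h (φ a) (isOpen_φ a) ha
  · intro h U hU hx
    obtain ⟨_, ⟨a, rfl⟩, hxa, haU⟩ := φ_basis.exists_subset_of_mem_open hx hU
    exact haU (h a hxa)

lemma φ_subset_iff {a b : A} : φ a ⊆ φ b ↔ a ≤ b := by
  constructor
  · intro h
    by_cases ha : a = ⊥
    · exact ha ▸ bot_le
    · exact (ProperFilter.mem_up (ha := ha)).1
        (h (show ProperFilter.up a ha ∈ φ a from (ProperFilter.mem_up (ha := ha) (c := a)).2 le_rfl))
  · exact fun h x hx => x.1.mem_of_le h hx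

lemma φ_injective : Function.Injective (φ (A := A)) := fun _ _ h =>
  le_antisymm (φ_subset_iff.1 h.le) (φ_subset_iff.1 h.ge)

lemma isCompact_φ (a : A) : IsCompact (φ a) := by
  by_cases ha : a = ⊥
  · rw [ha, φ_bot]
    exact isCompact_empty
  · refine isCompact_of_finite_subcover fun {ι} U hU hcov => ?_
    obtain ⟨i, hi⟩ := Set.mem_iUnion.1
      (hcov (show ProperFilter.up a ha ∈ φ a from (ProperFilter.mem_up (ha := ha) (c := a)).2 le_rfl))
    refine ⟨{i}, fun x hx => ?_⟩
    simp only [Finset.mem_singleton, Set.iUnion_iUnion_eq_left]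
    exact specLE_iff.2 (fun b hb => x.1.mem_of_le (ProperFilter.mem_up.1 hb) hx) _ (hU i) hi

/-- A filter not containing `a` extends to one containing `aᶜ`. -/
lemma exists_compl {x : ProperFilter A} {a : A} (ha : a ∉ x.1) :
    ∃ y : ProperFilter A, SpecLE x y ∧ aᶜ ∈ y.1 := by
  refine ⟨ProperFilter.gen {c | ∃ p ∈ x.1, c = p ⊓ aᶜ} ⟨_, ⊤, x.1.top_mem, rfl⟩ ?_ ?_, ?_, ?_⟩
  · rintro _ ⟨p, hp, rfl⟩ _ ⟨q, hq, rfl⟩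
    exact ⟨p ⊓ q, x.1.inf_mem hp hq, by rw [inf_inf_inf_comm, inf_idem]⟩
  · rintro ⟨p, hp, h⟩
    exact ha (x.1.mem_of_le (disjoint_compl_right_iff.1 (disjoint_iff.2 h.symm)) hp)
  · exact specLE_iff.2 fun p hp => ⟨p ⊓ aᶜ, ⟨p, hp, rfl⟩, inf_le_left⟩
  · exact ⟨⊤ ⊓ aᶜ, ⟨⊤, x.1.top_mem, rfl⟩, inf_le_right⟩

lemma star_φ (a : A) : star (φ a) = φ aᶜ := by
  ext x
  constructor
  · intro hx
    by_contra hc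
    obtain ⟨y, hy, hya⟩ := exists_compl (a := aᶜ) hc
    exact hx y hy (compl_compl a ▸ hya)
  · intro hx y hy hya
    refine y.bot_notMem ?_
    rw [← inf_compl_eq_bot (a := a)]
    exact y.1.inf_mem hya (specLE_iff.1 hy _ hx)

lemma isCOREG_φ (a : A) : IsCOREG (φ a) :=
  ⟨isCompact_φ a, isOpen_φ a, by rw [← star_star, star_φ, star_φ, compl_compl]⟩

lemma isCOREG_iff {U : Set (ProperFilter A)} : IsCOREG U ↔ ∃ a, U = φ a := by
  constructor
  · intro hU
    have key : ∃ b : A, star U = φ b := by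
      obtain ⟨s, hs, rfl⟩ := (isCompact_open_iff_eq_finite_iUnion_of_isTopologicalBasis φ φ_basis
        isCompact_φ U).1 ⟨hU.isCompact, hU.isOpen⟩
      clear hU
      induction s, hs using Set.Finite.induction_on with
      | empty => exact ⟨⊤, by simp [star_empty, φ_top]⟩
      | @insert a s _ _ ih =>
        obtain ⟨b, hb⟩ := ih
        exact ⟨aᶜ ⊓ b, by rw [Set.biUnion_insert, star_union, hb, star_φ, φ_inf]⟩
    obtain ⟨b, hb⟩ := key
    exact ⟨bᶜ, by rw [← hU.star_star, hb, star_φ]⟩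
  · rintro ⟨a, rfl⟩
    exact isCOREG_φ a

/-- `x ∩ {closed elements}` is the direct image of a filter under a quantifier. -/
lemma mem_image_quantifier {e : A → A} (he : IsQuantifier e) (x : ProperFilter A) (c : A) :
    c ∈ e '' (x.1 : Set A) ↔ c ∈ x.1 ∧ e c = c := by
  constructor
  · rintro ⟨a, ha, rfl⟩
    exact ⟨x.1.mem_of_le (he.le a) ha, he.idem a⟩
  · rintro ⟨hc, h⟩
    exact ⟨c, hc, h⟩

/-- `x` and `y` have the same direct image under `e`. -/
def filterRel (e : A → A) (x y : ProperFilter A) : Prop :=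
  e '' (x.1 : Set A) = e '' (y.1 : Set A)

lemma filterRel_iff {e : A → A} (he : IsQuantifier e) {x y : ProperFilter A} :
    filterRel e x y ↔ ∀ c, e c = c → (c ∈ x.1 ↔ c ∈ y.1) := by
  unfold filterRel
  rw [Set.ext_iff]
  refine forall_congr' fun c => ?_
  rw [mem_image_quantifier he, mem_image_quantifier he]
  tauto

lemma filterRel_equivalence (e : A → A) : Equivalence (filterRel e) :=
  ⟨fun _ => rfl, fun h => h.symm, fun h h' => h.trans h'⟩

lemma IsQuantifier.mono {e : A → A} (he : IsQuantifier e) {a b : A} (h : a ≤ b) : e a ≤ e b := by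
  rw [← sup_eq_right.2 h, he.map_sup]
  exact le_sup_left

/-- If `q ⊓ p ≤ c` with `p`, `c` closed, then `e q ⊓ p ≤ c`. -/
lemma IsQuantifier.ex_inf_le {e : A → A} (he : IsQuantifier e) {p q c : A} (hp : e p = p)
    (hc : e c = c) (h : q ⊓ p ≤ c) : e q ⊓ p ≤ c := by
  have h1 : q ≤ pᶜ ⊔ c := by
    rw [sup_comm, ← le_himp_iff, himp_eq] at *
    exact h
  have h2 : e (pᶜ ⊔ c) = pᶜ ⊔ c := by
    rw [he.map_sup, hc]
    have := he.map_compl p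
    rw [hp] at this
    rw [this]
  have h3 := he.mono h1
  rw [h2, sup_comm, ← himp_eq, le_himp_iff] at h3
  exact h3

lemma relImage_φ {e : A → A} (he : IsQuantifier e) (a : A) :
    relImage (filterRel e) (φ a) = φ (e a) := by
  ext y
  constructor
  · rintro ⟨x, hx, hxy⟩
    exact ((filterRel_iff he).1 hxy _ (he.idem a)).1 (x.1.mem_of_le (he.le a) hx)
  · intro hy
    have key : ∀ p ∈ y.1, e p = p → ∀ c, e c = c → a ⊓ p ≤ c → c ∈ y.1 := fun p hp hp' c hc h =>
      y.1.mem_of_le (he.ex_inf_le hp' hc h) (y.1.inf_mem hy hp)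
    have inf_closed : ∀ p q, e p = p → e q = q → e (p ⊓ q) = p ⊓ q := fun p q hp hq =>
      le_antisymm (le_inf ((he.mono inf_le_left).trans hp.le) ((he.mono inf_le_right).trans hq.le))
        (he.le _)
    refine ⟨ProperFilter.gen {c | ∃ p ∈ y.1, e p = p ∧ c = a ⊓ p}
      ⟨_, ⊤, y.1.top_mem, top_le_iff.1 (he.le ⊤), rfl⟩ ?_ ?_, ?_, ?_⟩
    · rintro _ ⟨p, hp, hp', rfl⟩ _ ⟨q, hq, hq', rfl⟩
      exact ⟨p ⊓ q, y.1.inf_mem hp hq, inf_closed p q hp' hq', by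
        rw [inf_inf_inf_comm, inf_idem]⟩
    · rintro ⟨p, hp, hp', h⟩
      exact y.bot_notMem (key p hp hp' ⊥ he.map_bot h.ge)
    · exact ⟨a ⊓ ⊤, ⟨⊤, y.1.top_mem, top_le_iff.1 (he.le ⊤), rfl⟩, inf_le_left⟩
    · refine (filterRel_iff he).2 fun c hc => ⟨?_, fun h => ?_⟩
      · rintro ⟨_, ⟨p, hp, hp', rfl⟩, h⟩
        exact key p hp hp' c hc h
      · exact ⟨a ⊓ c, ⟨c, h, hc, rfl⟩, inf_le_right⟩

lemma filterRel_comm_le {e f : A → A} (he : IsQuantifier e) (hf : IsQuantifier f)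
    (hef : ∀ a, e (f a) = f (e a)) {x z : ProperFilter A}
    (h : Relation.Comp (filterRel e) (filterRel f) x z) :
    Relation.Comp (filterRel f) (filterRel e) x z := by
  obtain ⟨y, hxy, hyz⟩ := h
  rw [filterRel_iff he] at hxy
  rw [filterRel_iff hf] at hyz
  have inf_closed : ∀ {e : A → A}, IsQuantifier e → ∀ p q, e p = p → e q = q →
      e (p ⊓ q) = p ⊓ q := fun he p q hp hq =>
    le_antisymm (le_inf ((he.mono inf_le_left).trans hp.le) ((he.mono inf_le_right).trans hq.le))
      (he.le _)
  have key1 : ∀ p ∈ x.1, f p = p → ∀ q ∈ z.1, e q = q → ∀ c, f c = c → p ⊓ q ≤ c → c ∈ x.1 := by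
    intro p hp hp' q hq hq' c hc h
    refine x.1.mem_of_le (hf.ex_inf_le (q := q) hp' hc (inf_comm p q ▸ h)) (x.1.inf_mem ?_ hp)
    refine (hxy (f q) (by rw [hef, hq'])).2 ((hyz (f q) (hf.idem q)).2 ?_)
    exact z.1.mem_of_le (hf.le q) hq
  have key2 : ∀ p ∈ x.1, f p = p → ∀ q ∈ z.1, e q = q → ∀ c, e c = c → p ⊓ q ≤ c → c ∈ z.1 := by
    intro p hp hp' q hq hq' c hc h
    refine z.1.mem_of_le (he.ex_inf_le (q := p) hq' hc h) (z.1.inf_mem ?_ hq)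
    refine (hyz (e p) (by rw [← hef, hp'])).1 ((hxy (e p) (he.idem p)).1 ?_)
    exact x.1.mem_of_le (he.le p) hp
  have ht : ∀ {e : A → A}, IsQuantifier e → e ⊤ = ⊤ := fun he => top_le_iff.1 (he.le ⊤)
  refine ⟨ProperFilter.gen {c | ∃ p ∈ x.1, f p = p ∧ ∃ q ∈ z.1, e q = q ∧ c = p ⊓ q}
    ⟨_, ⊤, x.1.top_mem, ht hf, ⊤, z.1.top_mem, ht he, rfl⟩ ?_ ?_, ?_, ?_⟩
  · rintro _ ⟨p, hp, hp', q, hq, hq', rfl⟩ _ ⟨r, hr, hr', s, hs, hs', rfl⟩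
    exact ⟨p ⊓ r, x.1.inf_mem hp hr, inf_closed hf p r hp' hr', q ⊓ s, z.1.inf_mem hq hs,
      inf_closed he q s hq' hs', inf_inf_inf_comm _ _ _ _⟩
  · rintro ⟨p, hp, hp', q, hq, hq', h⟩
    exact x.bot_notMem (key1 p hp hp' q hq hq' ⊥ hf.map_bot h.ge)
  · refine (filterRel_iff hf).2 fun c hc => ⟨fun h => ?_, ?_⟩
    · exact ⟨c ⊓ ⊤, ⟨c, h, hc, ⊤, z.1.top_mem, ht he, rfl⟩, inf_le_left⟩
    · rintro ⟨_, ⟨p, hp, hp', q, hq, hq', rfl⟩, h⟩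
      exact key1 p hp hp' q hq hq' c hc h
  · refine (filterRel_iff he).2 fun c hc => ⟨?_, fun h => ?_⟩
    · rintro ⟨_, ⟨p, hp, hp', q, hq, hq', rfl⟩, h⟩
      exact key2 p hp hp' q hq hq' c hc h
    · exact ⟨⊤ ⊓ c, ⟨⊤, x.1.top_mem, ht hf, c, h, hc, rfl⟩, inf_le_right⟩

variable (A) in
lemma isUVSpace_properFilter : IsUVSpace (ProperFilter A) where
  t0 := ⟨fun x y h => ProperFilter.ext' fun a =>
    (inseparable_iff_forall_isOpen.1 h) (φ a) (isOpen_φ a)⟩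
  inter_mem U V hU hV := by
    obtain ⟨a, rfl⟩ := isCOREG_iff.1 hU
    obtain ⟨b, rfl⟩ := isCOREG_iff.1 hV
    exact φ_inf a b ▸ isCOREG_φ _
  star_mem U hU := by
    obtain ⟨a, rfl⟩ := isCOREG_iff.1 hU
    exact star_φ a ▸ isCOREG_φ _
  isBasis := by
    have h : {U : Set (ProperFilter A) | IsCOREG U} = Set.range φ := by
      ext U
      exact isCOREG_iff.trans ⟨fun ⟨a, h⟩ => ⟨a, h.symm⟩, fun ⟨a, h⟩ => ⟨a, h.symm⟩⟩
    exact h ▸ φ_basis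
  exists_point F hF := by
    let P : A → COREG (ProperFilter A) := fun a => ⟨φ a, isCOREG_φ a⟩
    have hP : ∀ {a b}, a ≤ b → P a ≤ P b := fun h => φ_subset_iff.2 h
    have hsurj : ∀ U, ∃ a, U = P a := fun U => by
      obtain ⟨a, ha⟩ := isCOREG_iff.1 U.2
      exact ⟨a, Subtype.ext ha⟩
    refine ⟨ProperFilter.gen {a | P a ∈ F} ?_ ?_ ?_, ?_⟩
    · obtain ⟨U, hU⟩ := F.nonempty
      obtain ⟨a, rfl⟩ := hsurj U
      exact ⟨a, hU⟩
    · intro a ha b hb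
      obtain ⟨W, hW, hWa, hWb⟩ := F.directed (P a) ha (P b) hb
      refine F.mem_of_le (x := W) (fun x hx => ?_) hW
      exact (φ_inf a b).ge ⟨hWa hx, hWb hx⟩
    · intro h
      refine hF (Set.eq_univ_of_forall fun U => F.mem_of_le (x := P ⊥) (fun x hx => ?_) h)
      exact (x.bot_notMem hx).elim
    · ext U
      obtain ⟨a, rfl⟩ := hsurj U
      exact ⟨fun h => ⟨a, h, le_rfl⟩, fun ⟨p, hp, hpa⟩ => F.mem_of_le (hP hpa) hp⟩

end Filters

/-- The spectrum of proper filters of a cylindric Boolean algebra, with `x S_i y` iff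
`∃_i [x] = ∃_i [y]` and `Δ_{i,k} = φ (δ_{i,k})`. -/
def F₀ {I : Type v} (A : CBA.{u} I) : CUV.{u} I where
  carrier := ProperFilter A.carrier
  S i := filterRel (A.ex i)
  Δ i k := φ (A.diag i k)
  isUV := isUVSpace_properFilter A.carrier
  equiv i := filterRel_equivalence (A.ex i)
  comm i k := by
    ext x z
    exact ⟨filterRel_comm_le (A.quantifier i) (A.quantifier k) (A.ex_comm i k),
      filterRel_comm_le (A.quantifier k) (A.quantifier i) (A.ex_comm k i)⟩
  diag_regular i k := (isCOREG_φ _).star_star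
  diag_symm i k := by rw [A.diag_symm]
  diag_self i := by rw [A.diag_self, φ_top]
  diag_trans i k l hi hl := by
    rw [← φ_inf, relImage_φ (A.quantifier k), ← A.diag_trans i k l hi.symm hl.symm]
  diag_disj i k h U hU := by
    obtain ⟨a, rfl⟩ := isCOREG_iff.1 hU
    rw [star_φ, ← φ_inf, ← φ_inf, relImage_φ (A.quantifier i), relImage_φ (A.quantifier i),
      ← φ_inf, A.diag_disj i k a h, φ_bot]
  image_mem i U hU := by
    obtain ⟨a, rfl⟩ := isCOREG_iff.1 hU
    exact relImage_φ (A.quantifier i) a ▸ isCOREG_φ _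
  separated i x y hxy h := by
    refine hxy ?_
    have key : ∀ x : ProperFilter A.carrier, relImage (filterRel (A.ex i)) ''
        {U | IsCOREG U ∧ x ∈ U} = φ '' (A.ex i '' (x.1 : Set A.carrier)) := by
      intro x
      ext V
      constructor
      · rintro ⟨U, ⟨hU, hx⟩, rfl⟩
        obtain ⟨a, rfl⟩ := isCOREG_iff.1 hU
        exact ⟨_, ⟨a, hx, rfl⟩, (relImage_φ (A.quantifier i) a).symm⟩
      · rintro ⟨_, ⟨a, hx, rfl⟩, rfl⟩
        exact ⟨φ a, ⟨isCOREG_φ a, hx⟩, relImage_φ (A.quantifier i) a⟩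
    rw [key, key] at h
    exact φ_injective.image_injective h
  diag_compact i k := isCompact_φ _
  diag_open i k := isOpen_φ _

/-- The preimage of a proper filter under a homomorphism. -/
def comapFilter {I : Type v} {A B : CBA.{u} I} (h : A ⟶ B) (x : ProperFilter B.carrier) :
    ProperFilter A.carrier :=
  ⟨Order.IsPFilter.toPFilter (F := h.toFun ⁻¹' (x.1 : Set B.carrier)) (Order.IsPFilter.of_def
    ⟨⊤, by
      rw [Set.mem_preimage, h.map_top]
      exact x.1.top_mem⟩
    (fun a ha b hb => ⟨a ⊓ b, by
      rw [Set.mem_preimage, h.map_inf]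
      exact x.1.inf_mem ha hb, inf_le_left, inf_le_right⟩)
    (by
      intro a b hab ha
      have hb : h.toFun a ≤ h.toFun b := by
        rw [← inf_eq_left, ← h.map_inf, inf_eq_left.2 hab]
      exact x.1.mem_of_le hb ha)),
    fun hu => x.bot_notMem (by
      have hm : h.toFun ⊥ ∈ x.1 := Set.eq_univ_iff_forall.1 hu ⊥
      rwa [h.map_bot] at hm)⟩

lemma mem_comapFilter {I : Type v} {A B : CBA.{u} I} {h : A ⟶ B} {x : ProperFilter B.carrier}
    {a : A.carrier} : a ∈ (comapFilter h x).1 ↔ h.toFun a ∈ x.1 := Iff.rfl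

lemma preimage_φ {I : Type v} {A B : CBA.{u} I} (h : A ⟶ B) (a : A.carrier) :
    comapFilter h ⁻¹' φ a = φ (h.toFun a) := rfl

lemma isSpectralMap_comapFilter {I : Type v} {A B : CBA.{u} I} (h : A ⟶ B) :
    IsSpectralMap (comapFilter h) := by
  have hc : Continuous (comapFilter h) := by
    refine continuous_generateFrom_iff.2 ?_
    rintro _ ⟨a, rfl⟩
    exact isOpen_φ _
  refine ⟨hc, fun {U} hU hU' => ?_⟩
  obtain ⟨s, hs, rfl⟩ := (isCompact_open_iff_eq_finite_iUnion_of_isTopologicalBasis φ φ_basis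
    isCompact_φ U).1 ⟨hU', hU⟩
  rw [Set.preimage_iUnion₂]
  exact hs.isCompact_biUnion fun a _ => isCompact_φ (h.toFun a)

/-- The action `h ↦ h⁻¹` on homomorphisms. -/
def F₁ {I : Type v} {A B : CBA.{u} I} (h : A ⟶ B) : F₀ B ⟶ F₀ A where
  toFun := comapFilter h
  spectral := isSpectralMap_comapFilter h
  back x y' hy' := by
    replace hy' := specLE_iff.1 hy'
    have hmono : ∀ {a b}, a ≤ b → h.toFun a ≤ h.toFun b := fun {a b} hab => by
      rw [← inf_eq_left, ← h.map_inf, inf_eq_left.2 hab]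
    have key : ∀ p ∈ x.1, ∀ q ∈ y'.1, ∀ a, p ⊓ h.toFun q ≤ h.toFun a → a ∈ y'.1 := by
      intro p hp q hq a hpq
      have h1 : a ⊔ qᶜ ∈ y'.1 := by
        refine hy' _ (mem_comapFilter.2 (x.1.mem_of_le ?_ hp))
        rw [h.map_sup, h.map_compl, ← himp_eq, le_himp_iff]
        exact hpq
      refine y'.1.mem_of_le ?_ (y'.1.inf_mem h1 hq)
      rw [← le_himp_iff, himp_eq]
    refine ⟨ProperFilter.gen {c | ∃ p ∈ x.1, ∃ q ∈ y'.1, c = p ⊓ h.toFun q}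
      ⟨_, ⊤, x.1.top_mem, ⊤, y'.1.top_mem, rfl⟩ ?_ ?_, ?_, ?_⟩
    · rintro _ ⟨p, hp, q, hq, rfl⟩ _ ⟨r, hr, s, hs, rfl⟩
      exact ⟨p ⊓ r, x.1.inf_mem hp hr, q ⊓ s, y'.1.inf_mem hq hs, by
        rw [h.map_inf, inf_inf_inf_comm]⟩
    · rintro ⟨p, hp, q, hq, he⟩
      exact y'.bot_notMem (key p hp q hq ⊥ (he.ge.trans bot_le))
    · exact specLE_iff.2 fun p hp => ⟨p ⊓ h.toFun ⊤, ⟨p, hp, ⊤, y'.1.top_mem, rfl⟩, inf_le_left⟩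
    · refine ProperFilter.ext' fun a => ⟨?_, fun ha => ?_⟩
      · rintro ⟨_, ⟨p, hp, q, hq, rfl⟩, hle⟩
        exact key p hp q hq a hle
      · exact ⟨⊤ ⊓ h.toFun a, ⟨⊤, x.1.top_mem, a, ha, rfl⟩, inf_le_right⟩
  preimage_image i U hU := by
    obtain ⟨a, rfl⟩ := isCOREG_iff.1 hU
    change relImage (filterRel (B.ex i)) (φ (h.toFun a)) =
      comapFilter h ⁻¹' relImage (filterRel (A.ex i)) (φ a)
    rw [relImage_φ (B.quantifier i), relImage_φ (A.quantifier i), preimage_φ, h.map_ex]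
  preimage_diag i k := by
    change comapFilter h ⁻¹' φ (A.diag i k) = φ (B.diag i k)
    rw [preimage_φ, h.map_diag]

/-- The contravariant functor from cylindric Boolean algebras to cylindric UV-spaces. -/
def F (I : Type v) : (CBA.{u} I)ᵒᵖ ⥤ CUV.{u} I where
  obj A := F₀ A.unop
  map h := F₁ h.unop

end CylDual

namespace CylDual

variable {I : Type v}

/-! ### A cylindric Boolean algebra is isomorphic to its double dual -/

/-! The points of the dual space are all proper filters, so each nonzero `a` gives the point "filter
of elements above `a`". These principal filters make `φ` an order embedding and each `φ a` compact,
and no ultrafilters are needed. The duality rests on two natural isomorphisms.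

On the algebraic side, `φ` maps `A` onto the compact open regular sets (`isCOREG_iff`). A compact
open set is a finite union of sets `φ a`. Its star is a finite intersection of sets `φ aᶜ`, hence
again some `φ b`, and regularity recovers the set as `φ bᶜ`. The quantifiers match by `relImage_φ`:
if `y` contains `∃ᵢ a`, then `a` and the `∃ᵢ`-closed members of `y` generate a proper filter that is
`Sᵢ`-related to `y`.

On the spatial side, a point goes to its filter of compact open regular neighbourhoods. The `T₀` and
filter axioms make this map bijective, and the basis axiom makes it a homeomorphism. Morphisms
constrain the relations only through the images `Sᵢ[U]` of compact open regular `U`, so `relImage_φ`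
in the algebra `G₀ X` is all that an isomorphism requires. -/

/-- The representation `a ↦ φ a` as a homomorphism. -/
def CBA.repr (A : CBA.{u} I) : A ⟶ G₀ (F₀ A) where
  toFun a := ⟨φ a, isCOREG_φ a⟩
  map_inf a b := Subtype.ext (φ_inf a b)
  map_sup a b := Subtype.ext (by
    change φ (a ⊔ b) = intUp (clUp (φ a ∪ φ b))
    -- Filters need not be prime, so `φ a ∪ φ b` may be smaller than `φ (a ⊔ b)`. Writing the
    -- regularization as a double star reduces the claim to De Morgan in `A`.
    rw [← star_star, star_union, star_φ, star_φ, ← φ_inf, star_φ, compl_inf, compl_compl,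
      compl_compl])
  map_bot := Subtype.ext φ_bot
  map_top := Subtype.ext φ_top
  map_compl a := Subtype.ext (star_φ a).symm
  map_ex i a := Subtype.ext (relImage_φ (A.quantifier i) a).symm
  map_diag _ _ := rfl

/-- Principal filters separate elements, and every compact open regular set of filters has the form
`φ a`. -/
lemma CBA.repr_bijective (A : CBA.{u} I) : Function.Bijective A.repr.toFun := by
  refine ⟨fun a b h => φ_injective (congrArg Subtype.val h), fun U => ?_⟩
  obtain ⟨a, ha⟩ := isCOREG_iff.1 U.2
  exact ⟨a, Subtype.ext ha.symm⟩

/-- A bijective homomorphism of cylindric Boolean algebras is an isomorphism. -/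
noncomputable def CBA.isoOfBijective {A B : CBA.{u} I} (h : A ⟶ B)
    (hb : Function.Bijective h.toFun) : A ≅ B where
  hom := h
  inv :=
    have hr := (Equiv.ofBijective _ hb).apply_symm_apply
    { toFun := (Equiv.ofBijective _ hb).symm
      -- Each identity for the inverse is checked after applying the injective map `h`, where `hr`
      -- cancels the inverse.
      map_inf := fun a b => hb.1 (by
        rw [h.map_inf]
        exact (hr _).trans (congrArg₂ _ (hr a) (hr b)).symm)
      map_sup := fun a b => hb.1 (by
        rw [h.map_sup]
        exact (hr _).trans (congrArg₂ _ (hr a) (hr b)).symm)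
      map_bot := hb.1 (by rw [h.map_bot]; exact hr _)
      map_top := hb.1 (by rw [h.map_top]; exact hr _)
      map_compl := fun a => hb.1 (by
        rw [h.map_compl]
        exact (hr _).trans (congrArg _ (hr a)).symm)
      map_ex := fun i a => hb.1 (by
        rw [h.map_ex]
        exact (hr _).trans (congrArg _ (hr a)).symm)
      map_diag := fun i k => hb.1 (by rw [h.map_diag]; exact hr _) }
  hom_inv_id := CBA.Hom.ext (funext (Equiv.ofBijective _ hb).symm_apply_apply)
  inv_hom_id := CBA.Hom.ext (funext (Equiv.ofBijective _ hb).apply_symm_apply)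

/-- The isomorphism of a cylindric Boolean algebra with its double dual. -/
noncomputable def CBA.reprIso (A : CBA.{u} I) : A ≅ G₀ (F₀ A) :=
  CBA.isoOfBijective A.repr A.repr_bijective

/-- A filter contains `h a` exactly when its preimage under `h` contains `a`; this is the definition
of `comapFilter`. -/
lemma CBA.repr_naturality {A B : CBA.{u} I} (h : A ⟶ B) : h ≫ B.repr = A.repr ≫ G₁ (F₁ h) :=
  rfl

/-! ### A cylindric UV-space is isomorphic to its double dual -/

/-- The proper filter of the compact open regular open neighbourhoods of a point. -/
def CUV.nhdFilter (X : CUV.{u} I) (x : X.carrier) : ProperFilter (G₀ X).carrier :=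
  ⟨Order.IsPFilter.toPFilter (F := {U : COREG X.carrier | x ∈ U.1}) (Order.IsPFilter.of_def
    ⟨⟨Set.univ, X.isUV.univ_mem⟩, trivial⟩
    (fun U hU V hV => ⟨⟨U.1 ∩ V.1, X.isUV.inter_mem _ _ U.2 V.2⟩, ⟨hU, hV⟩,
      Set.inter_subset_left, Set.inter_subset_right⟩)
    (fun hUV hU => hUV hU)),
    fun h => (Set.eq_univ_iff_forall.1 h ⟨∅, isCOREG_empty⟩ : x ∈ (∅ : Set X.carrier))⟩

lemma CUV.mem_nhdFilter (X : CUV.{u} I) {x : X.carrier} {U : COREG X.carrier} :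
    U ∈ (X.nhdFilter x).1 ↔ x ∈ U.1 := Iff.rfl

/-- This identity transports all the structure: continuity, images under the relations and diagonals
are all compared through the sets `φ U`. -/
lemma CUV.preimage_nhdFilter (X : CUV.{u} I) (U : (G₀ X).carrier) :
    X.nhdFilter ⁻¹' φ U = U.1 := rfl

/-- Points lying in the same basic open sets are inseparable, hence equal by `T₀`. Surjectivity is
the axiom that every proper filter comes from a point. -/
lemma CUV.nhdFilter_bijective (X : CUV.{u} I) : Function.Bijective X.nhdFilter := by
  constructor
  · intro x y h
    have := X.isUV.t0
    refine (X.isUV.isBasis.inseparable_iff.2 fun U hU => ?_).eq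
    exact (X.mem_nhdFilter (U := ⟨U, hU⟩)).symm.trans (by rw [h]; exact X.mem_nhdFilter)
  · intro F
    obtain ⟨x, hx⟩ := X.isUV.exists_point F.1 F.2
    exact ⟨x, ProperFilter.ext' fun U => (Set.ext_iff.1 hx U).symm⟩

/-- A point of a cylindric UV-space corresponds to its neighbourhood filter, homeomorphically. -/
noncomputable def CUV.nhdHomeomorph (X : CUV.{u} I) : X.carrier ≃ₜ (F₀ (G₀ X)).carrier :=
  (Equiv.ofBijective _ X.nhdFilter_bijective).toHomeomorph fun W => by
    constructor
    · intro h
      have h' : IsOpen (X.nhdFilter ⁻¹' W) := h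
      rw [isOpen_iff_forall_mem_open]
      intro F hF
      obtain ⟨x, rfl⟩ := X.nhdFilter_bijective.2 F
      obtain ⟨U, hU, hxU, hUW⟩ := X.isUV.isBasis.exists_subset_of_mem_open hF h'
      -- A basic `U` around `x` inside the preimage of `W` yields the neighbourhood `φ U`. It lies
      -- in `W` because each of its filters is again the filter of some point, which then belongs to
      -- `U`.
      refine ⟨φ (⟨U, hU⟩ : (G₀ X).carrier), fun F hF => ?_, isOpen_φ _, hxU⟩
      obtain ⟨y, rfl⟩ := X.nhdFilter_bijective.2 F
      exact hUW hF
    · exact fun h => (continuous_generateFrom_iff.2 (by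
        rintro _ ⟨U, rfl⟩
        exact U.2.isOpen) : Continuous X.nhdFilter).isOpen_preimage W h

/-- A homeomorphism compatible with the relations and the diagonals is a cylindric UV-map. -/
def CUV.homOfHomeomorph {X Y : CUV.{u} I} (e : X.carrier ≃ₜ Y.carrier)
    (hS : ∀ i U, IsCOREG U → relImage (X.S i) (e ⁻¹' U) = e ⁻¹' relImage (Y.S i) U)
    (hΔ : ∀ i k, e ⁻¹' Y.Δ i k = X.Δ i k) : X ⟶ Y where
  toFun := e
  spectral := ⟨e.continuous, fun {_} _ hU => e.isCompact_preimage.2 hU⟩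
  -- Continuous maps preserve specialization, so `e.symm` carries the relation `e x ≤ y'` back to
  -- `X`.
  back x y' h := ⟨e.symm y', by simpa using h.map e.symm.continuous, e.apply_symm_apply y'⟩
  preimage_image := hS
  preimage_diag := hΔ

/-- The counterpart of `preimage_nhdFilter` for the inverse map, needed to see that the inverse is
also a cylindric UV-map. -/
lemma CUV.preimage_nhdHomeomorph_symm (X : CUV.{u} I) (U : (G₀ X).carrier) :
    X.nhdHomeomorph.symm ⁻¹' U.1 = φ U := by
  rw [← X.preimage_nhdFilter U]
  exact X.nhdHomeomorph.symm_preimage_preimage (φ U)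

/-- The isomorphism of a cylindric UV-space with its double dual. -/
noncomputable def CUV.nhdIso (X : CUV.{u} I) : X ≅ F₀ (G₀ X) where
  hom := CUV.homOfHomeomorph X.nhdHomeomorph
    (fun i W hW => by
      obtain ⟨U, rfl⟩ := isCOREG_iff.1 hW
      -- The set `Sᵢ[U]` is by definition the quantifier of `G₀ X` applied to `U`, hence the
      -- preimage of `φ` of that element.
      exact congrArg (X.nhdFilter ⁻¹' ·) (relImage_φ ((G₀ X).quantifier i) U).symm)
    (fun _ _ => rfl)
  inv := CUV.homOfHomeomorph X.nhdHomeomorph.symm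
    (fun i U hU => by
      let V : (G₀ X).carrier := ⟨U, hU⟩
      exact (congrArg _ (X.preimage_nhdHomeomorph_symm V)).trans
        ((relImage_φ ((G₀ X).quantifier i) V).trans
          (X.preimage_nhdHomeomorph_symm ((G₀ X).ex i V)).symm))
    (fun i k => X.preimage_nhdHomeomorph_symm ((G₀ X).diag i k))
  hom_inv_id := CUV.Hom.ext (funext X.nhdHomeomorph.symm_apply_apply)
  inv_hom_id := CUV.Hom.ext (funext X.nhdHomeomorph.apply_symm_apply)

/-- Both composites send `x` to the filter of those `U` with `f x ∈ U`, that is, `x ∈ f⁻¹ U`. -/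
lemma CUV.nhdIso_naturality {X Y : CUV.{u} I} (f : X ⟶ Y) :
    f ≫ Y.nhdIso.hom = X.nhdIso.hom ≫ F₁ (G₁ f) := rfl

/-! ### The dual equivalence -/

/-- The unit of the duality. -/
noncomputable def unitIso (I : Type v) : 𝟭 (CBA.{u} I)ᵒᵖ ≅ F I ⋙ (G I).rightOp :=
  -- Passing to the opposite category reverses arrows, so the component at `A` is the opposite of
  -- the inverse of `repr`. Moving the inverses across turns the square into `repr_naturality`.
  NatIso.ofComponents (fun A => (CBA.reprIso A.unop).symm.op) fun {A B} h => by
    refine Quiver.Hom.unop_inj ?_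
    change (CBA.reprIso B.unop).inv ≫ h.unop = G₁ (F₁ h.unop) ≫ (CBA.reprIso A.unop).inv
    rw [Iso.inv_comp_eq, ← Category.assoc, Iso.eq_comp_inv]
    exact CBA.repr_naturality h.unop

/-- The counit of the duality. -/
noncomputable def counitIso (I : Type v) : (G I).rightOp ⋙ F I ≅ 𝟭 (CUV.{u} I) :=
  (NatIso.ofComponents (fun X => X.nhdIso) CUV.nhdIso_naturality).symm

end CylDual

theorem mainTheorem6 (I : Type v) :
    ∃ e : (CylDual.CBA.{u} I)ᵒᵖ ≌ CylDual.CUV.{u} I,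
      e.functor = CylDual.F I ∧ e.inverse = (CylDual.G I).rightOp := by
  -- No triangle identity has to be checked: `Equivalence.mk` corrects the unit and leaves both
  -- functors unchanged, so the two equations are definitional.
  exact ⟨.mk (CylDual.F I) (CylDual.G I).rightOp (CylDual.unitIso I) (CylDual.counitIso I),
    rfl, rfl⟩
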